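/- Let $H$ and $G_1,\dots,G_m$ ($m\ge 1$) be real Hilbert spaces. Let $f:H\to\mathbb R$ be convex and differentiable with $L$-Lipschitz continuous gradient, $L\in(0,+\infty)$; let $g\in\Gamma_0(H)$ and $h_i\in\Gamma_0(G_i)$, where $\Gamma_0$ denotes the class of proper lower semicontinuous convex functions with values in $(-\infty,+\infty]$; and let $B_i:H\to G_i$ be bounded linear operators, $i=1,\dots,m$. Consider the problem $$\min_{x\in H}\; f(x)+g(x)+\sum_{i=1}^m h_i(B_ix). \tag{1.1}$$ Assume that its optimality system is solvable, i.e. there is $\bar x\in H$ with $$0\in\nabla f(\bar x)+\partial g(\bar x)+\sum_{i=1}^m B_i^*\,\partial h_i(B_i\bar x).$$ Write $\mathrm{prox}_{t\varphi}(u)=\arg\min_x\{\tfrac12\|x-u\|^2+t\varphi(x)\}$ for the proximity operator and $h_i^*(y)=\sup_x\{\langle x,y\rangle-h_i(x)\}$ for the Fenchel conjugate. Let $\mathbf G=G_1\times\cdots\times G_m$ be equipped with the inner product $\langle\mathbf y,\mathbf z\rangle_{2,\mathbf G}=\sum_{i=1}^m\langle y_i,z_i\rangle_{G_i}$. Let $\gamma\in(0,2/L)$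 and $0<\lambda<1/\sum_{i=1}^m\|B_i\|^2$ (with $1/0=+\infty$). For arbitrary $x^0\in H$ and $\mathbf y^0=(y^0_1,\dots,y^0_m)\in\mathbf G$, let the sequences $\{u^k\}$, $\{\mathbf y^k\}$, $\{x^k\}$ be generated by the dual forward-backward splitting algorithm with one inner iteration per outer step, that is, for $k=0,1,2,\dots$, $$\begin{aligned} u^k&=x^k-\gamma\nabla f(x^k),\\ y_i^{k+1}&=\mathrm{prox}_{\frac{\lambda}{\gamma}h_i^*}\Big(y_i^k+\tfrac{\lambda}{\gamma}B_i\,\mathrm{prox}_{\gamma g}\big(u^k-\gamma\textstyle\sum_{l=1}^m B_l^*y_l^k\big)\Big),\qquad i=1,\dots,m,\\ x^{k+1}&=\mathrm{prox}_{\gamma g}\Big(u^k-\gamma\textstyle\sum_{i=1}^m B_i^*y_i^{k+1}\Big). \end{aligned}$$ Then $\{x^k\}$ converges weakly to a solution of (1.1). -/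

import Mathlib

open Set Filter Topology InnerProductSpace

namespace CompositeSplitting

noncomputable section

/-- `IsGammaZero φ`: the function `φ : E → (-∞, +∞]` is proper, lower semicontinuous and convex,
that is, `φ` belongs to the class `Γ₀(E)`. -/
structure IsGammaZero {E : Type*} [NormedAddCommGroup E] [InnerProductSpace ℝ E]
    (φ : E → EReal) : Prop where
  ne_bot : ∀ x, φ x ≠ ⊥
  exists_ne_top : ∃ x, φ x ≠ ⊤
  lsc : LowerSemicontinuous φ
  convex : ∀ x y : E, ∀ a b : ℝ, 0 < a → 0 < b → a + b = 1 →
    φ (a • x + b • y) ≤ (a : EReal) * φ x + (b : EReal) * φ y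

/-- The Fenchel conjugate `φ*(y) = sup_x (⟨x, y⟩ - φ(x))`. -/
def fenchelConj {E : Type*} [NormedAddCommGroup E] [InnerProductSpace ℝ E]
    (φ : E → EReal) (y : E) : EReal :=
  ⨆ x : E, ((inner ℝ x y : ℝ) : EReal) - φ x

/-- The convex subdifferential of `φ` at `x`. -/
def subdiff {E : Type*} [NormedAddCommGroup E] [InnerProductSpace ℝ E]
    (φ : E → EReal) (x : E) : Set E :=
  {v | ∀ z : E, φ x + ((inner ℝ v (z - x) : ℝ) : EReal) ≤ φ z}

/-- `p` minimizes `x ↦ ½ ‖x - u‖² + t φ(x)` over the whole space. -/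
def IsProxPoint {E : Type*} [NormedAddCommGroup E] [InnerProductSpace ℝ E]
    (t : ℝ) (φ : E → EReal) (u p : E) : Prop :=
  IsMinOn (fun x : E => ((1 / 2 * ‖x - u‖ ^ 2 : ℝ) : EReal) + (t : EReal) * φ x) univ p

/-- The proximity operator `prox_{t φ}(u) = argmin_x { ½ ‖x - u‖² + t φ(x) }`. For `t > 0` and
`φ ∈ Γ₀(E)`, `E` a Hilbert space, there is exactly one minimizer, and `prox t φ u` is that point. -/
def prox {E : Type*} [NormedAddCommGroup E] [InnerProductSpace ℝ E]
    (t : ℝ) (φ : E → EReal) (u : E) : E :=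
  Classical.epsilon (IsProxPoint t φ u)

section Algorithm

variable {H : Type*} [NormedAddCommGroup H] [InnerProductSpace ℝ H] [CompleteSpace H]
  {m : ℕ} {G : Fin m → Type*} [∀ i, NormedAddCommGroup (G i)] [∀ i, InnerProductSpace ℝ (G i)]
  [∀ i, CompleteSpace (G i)]

/-- The objective function `f(x) + g(x) + ∑ i, h_i(B_i x)`. -/
def objective (f : H → ℝ) (g : H → EReal) (h : ∀ i, G i → EReal) (B : ∀ i, H →L[ℝ] G i)
    (x : H) : EReal :=
  (f x : EReal) + g x + ∑ i, h i (B i x)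

/-- The operator `y ↦ ∑ i, B_i^* y_i` on `G = G_1 × ⋯ × G_m`, where `G` is the Hilbert space with
the inner product `⟨y, z⟩ = ∑ i, ⟨y_i, z_i⟩`. -/
def adjointSum (B : ∀ i, H →L[ℝ] G i) (y : PiLp 2 G) : H :=
  ∑ i, ContinuousLinearMap.adjoint (B i) (y i)

/-- One inner step of the dual forward-backward splitting algorithm: the `i`-th component of the
new dual variable is
`prox_{(lam/γ) h_i^*} (y_i + (lam/γ) B_i prox_{γ g} (u - γ ∑ l, B_l^* y_l))`. -/
def innerStep (g : H → EReal) (h : ∀ i, G i → EReal) (B : ∀ i, H →L[ℝ] G i) (γ lam : ℝ)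
    (u : H) (y : PiLp 2 G) : PiLp 2 G :=
  WithLp.toLp 2 fun i =>
    prox (lam / γ) (fenchelConj (h i))
      (y i + (lam / γ) • B i (prox γ g (u - γ • adjointSum B y)))

/-- The sequences `u`, `y`, `x` are generated by the dual forward-backward splitting algorithm,
from the arbitrary starting points `x 0` and `y 0`, with `N k` inner iterations in the `k`-th outer
iteration. The inner iterations of outer step `k` start at `y k`, and `y (k + 1)` is their
output. -/
structure IsGenerated (f : H → ℝ) (g : H → EReal) (h : ∀ i, G i → EReal)
    (B : ∀ i, H →L[ℝ] G i) (γ lam : ℝ) (N : ℕ → ℕ)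
    (u : ℕ → H) (y : ℕ → PiLp 2 G) (x : ℕ → H) : Prop where
  u_eq : ∀ k, u k = x k - γ • gradient f (x k)
  y_succ : ∀ k, y (k + 1) = (innerStep g h B γ lam (u k))^[N k] (y k)
  x_succ : ∀ k, x (k + 1) = prox γ g (u k - γ • adjointSum B (y (k + 1)))

end Algorithm

end

end CompositeSplitting

/-! Stack the blocks: with `stackedOperator` and `separableSum` the problem becomes min f + g + h∘B
with one dual variable y, and λ‖B‖² < 1. Put w_k = prox_{γg}(u_k - γB*y_k), the primal point used
inside the inner step. The algorithm then amounts to three inclusions (`IsPrimalDualSeq`): one in ∂g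
at x_{k+1}, one in ∂g at w_k, and, by Moreau's decomposition, y_{k+1} ∈ ∂h((γ/λ)(y_k - y_{k+1}) +
Bw_k).

For a KKT pair (p, q), add 3-cyclic monotonicity of ∂g at x_{k+1}, p, w_k, monotonicity of ∂h, and
cocoercivity of ∇f. The result (`IsPrimalDualSeq.fejer`) is that ‖x_k - p‖² + (γ²/λ)‖y_k - q‖²
decreases by at least a positive combination of ‖∇f(x_k) - ∇f(p)‖², ‖x_k - w_k - γ(∇f(x_k) -
∇f(p))‖² and ‖y_{k+1} - y_k‖². Hence the iterates are bounded, ∇f(x_k) → ∇f(p), w_k - x_k → 0 and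
y_{k+1} - y_k → 0.

These limits make every weak cluster point a KKT pair (`IsPrimalDualSeq.isKKT_of_weak_limit`).
Opial's argument leaves only one cluster point, so x_k converges weakly, and a KKT point minimizes
the objective by convexity. -/

namespace CompositeSplitting

/-! ### Subdifferentials, proximity operators and conjugates of Γ₀ functions -/

section Convex

variable {E : Type*} [NormedAddCommGroup E] [InnerProductSpace ℝ E] {φ : E → EReal}

lemma IsGammaZero.convex_coe (hφ : IsGammaZero φ) {x y : E} {r s a b : ℝ} (hx : φ x ≤ r)
    (hy : φ y ≤ s) (ha : 0 < a) (hb : 0 < b) (hab : a + b = 1) :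
    φ (a • x + b • y) ≤ ((a * r + b * s : ℝ) : EReal) := by
  refine (hφ.convex x y a b ha hb hab).trans ?_
  rw [EReal.coe_add, EReal.coe_mul, EReal.coe_mul]
  exact add_le_add (mul_le_mul_of_nonneg_left hx (EReal.coe_nonneg.2 ha.le))
    (mul_le_mul_of_nonneg_left hy (EReal.coe_nonneg.2 hb.le))

lemma exists_coe_eq {c : EReal} (h₁ : c ≠ ⊥) (h₂ : c ≠ ⊤) : ∃ r : ℝ, c = r :=
  ⟨c.toReal, (EReal.coe_toReal h₂ h₁).symm⟩

lemma IsGammaZero.exists_real (hφ : IsGammaZero φ) : ∃ x, ∃ r : ℝ, φ x = r :=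
  let ⟨x, hx⟩ := hφ.exists_ne_top
  ⟨x, exists_coe_eq (hφ.ne_bot x) hx⟩

lemma IsGammaZero.le_of_tendsto (hφ : IsGammaZero φ) {ι : Type*} {l : Filter ι} [l.NeBot]
    {a : ι → E} {x : E} {r : ι → ℝ} {c : ℝ} (ha : Tendsto a l (𝓝 x)) (hr : Tendsto r l (𝓝 c))
    (h : ∀ i, φ (a i) ≤ r i) : φ x ≤ c := by
  by_contra! hlt
  obtain ⟨d, hd₁, hd₂⟩ := EReal.lt_iff_exists_real_btwn.1 hlt
  have h₁ := ha.eventually (hφ.lsc x d hd₂)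
  have h₂ := hr.eventually (gt_mem_nhds (EReal.coe_lt_coe_iff.1 hd₁))
  obtain ⟨i, hi₁, hi₂⟩ := (h₁.and h₂).exists
  exact absurd (hi₁.trans_le (h i)) (not_lt.2 (EReal.coe_le_coe_iff.2 hi₂.le))

lemma inner_add_le_of_mem_subdiff {x v z : E} {r s : ℝ} (hv : v ∈ subdiff φ x)
    (hx : φ x = r) (hz : φ z ≤ s) : r + inner ℝ v (z - x) ≤ s := by
  have := (hv z).trans hz
  rw [hx] at this
  exact_mod_cast this

lemma IsGammaZero.exists_real_of_mem_subdiff (hφ : IsGammaZero φ) {x v : E}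
    (hv : v ∈ subdiff φ x) : ∃ r : ℝ, φ x = r := by
  refine exists_coe_eq (hφ.ne_bot x) fun htop => ?_
  obtain ⟨z, r, hz⟩ := hφ.exists_real
  have := hv z
  rw [htop, hz, EReal.top_add_coe, top_le_iff] at this
  exact EReal.coe_ne_top _ this

lemma mem_subdiff_of_forall_real (hbot : ∀ z, φ z ≠ ⊥) {x v : E} {r : ℝ} (hx : φ x = r)
    (h : ∀ (z : E) (s : ℝ), φ z = s → r + inner ℝ v (z - x) ≤ s) : v ∈ subdiff φ x := by
  intro z
  by_cases hz : φ z = ⊤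
  · rw [hz]; exact le_top
  · obtain ⟨s, hs⟩ := exists_coe_eq (hbot z) hz
    rw [hx, hs]
    exact_mod_cast h z s hs

/-- Monotonicity of the subdifferential. -/
lemma IsGammaZero.inner_subdiff_nonneg (hφ : IsGammaZero φ) {x y v w : E}
    (hv : v ∈ subdiff φ x) (hw : w ∈ subdiff φ y) : 0 ≤ inner ℝ (v - w) (x - y) := by
  obtain ⟨r, hr⟩ := hφ.exists_real_of_mem_subdiff hv
  obtain ⟨s, hs⟩ := hφ.exists_real_of_mem_subdiff hw
  have h₁ := inner_add_le_of_mem_subdiff hv hr hs.le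
  have h₂ := inner_add_le_of_mem_subdiff hw hs hr.le
  rw [inner_sub_left]
  rw [← neg_sub x y, inner_neg_right] at h₁
  linarith

/-- 3-cyclic monotonicity of the subdifferential. -/
lemma IsGammaZero.subdiff_cyclic (hφ : IsGammaZero φ) {x y z u v w : E}
    (hu : u ∈ subdiff φ x) (hv : v ∈ subdiff φ y) (hw : w ∈ subdiff φ z) :
    inner ℝ u (y - x) + inner ℝ v (z - y) + inner ℝ w (x - z) ≤ 0 := by
  obtain ⟨r, hr⟩ := hφ.exists_real_of_mem_subdiff hu
  obtain ⟨s, hs⟩ := hφ.exists_real_of_mem_subdiff hv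
  obtain ⟨t, ht⟩ := hφ.exists_real_of_mem_subdiff hw
  have h₁ := inner_add_le_of_mem_subdiff hu hr hs.le
  have h₂ := inner_add_le_of_mem_subdiff hv hs ht.le
  have h₃ := inner_add_le_of_mem_subdiff hw ht hr.le
  linarith

/-- A function in `Γ₀` is bounded below by a function of linear growth. -/
lemma IsGammaZero.exists_linear_lower_bound (hφ : IsGammaZero φ) :
    ∃ (x₀ : E) (c C : ℝ), 0 ≤ C ∧ ∀ (z : E) (s : ℝ), φ z = s → c - C * ‖z - x₀‖ ≤ s := by
  obtain ⟨x₀, r, hr⟩ := hφ.exists_real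
  have hlt : ((r - 1 : ℝ) : EReal) < φ x₀ := by
    rw [hr]; exact_mod_cast sub_one_lt r
  obtain ⟨ε, hε, hball⟩ := Metric.eventually_nhds_iff.1 (hφ.lsc x₀ _ hlt)
  refine ⟨x₀, r - 1, 2 / ε, by positivity, fun z s hz => ?_⟩
  have hn := norm_nonneg (z - x₀)
  rcases lt_or_ge ‖z - x₀‖ ε with hd | hd
  · have := hball (y := z) (by rwa [dist_eq_norm])
    simp only [hz, gt_iff_lt, EReal.coe_lt_coe_iff] at this
    have : 0 ≤ 2 / ε * ‖z - x₀‖ := by positivity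
    linarith
  · have hd0 : 0 < ‖z - x₀‖ := hε.trans_le hd
    -- Contract z towards x₀ to distance ε/2, where φ > r - 1; convexity along the segment then
    -- gives s > r - 1/t.
    set t : ℝ := ε / 2 / ‖z - x₀‖ with ht
    have ht0 : 0 < t := by positivity
    have ht1 : t < 1 := by rw [ht, div_lt_one hd0]; linarith
    have hc := hφ.convex_coe hz.le hr.le ht0 (sub_pos.2 ht1) (by ring)
    have hb := hball (y := t • z + (1 - t) • x₀) (by
      rw [dist_eq_norm, show t • z + (1 - t) • x₀ - x₀ = t • (z - x₀) by module, norm_smul,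
        Real.norm_of_nonneg ht0.le, ht, div_mul_cancel₀ _ hd0.ne']
      linarith)
    have h₁ := EReal.coe_lt_coe_iff.1 (hb.trans_le hc)
    have h₂ : t * (2 / ε * ‖z - x₀‖) = 1 := by
      rw [ht]; field_simp
    have h₃ : t * (r - 2 / ε * ‖z - x₀‖) < t * s := by
      rw [mul_sub, h₂]; linarith
    have := lt_of_mul_lt_mul_left h₃ ht0.le
    linarith

/-- The parallelogram law, giving the uniform convexity that makes minimizing sequences Cauchy. -/
lemma half_norm_sq_midpoint (a b u : E) :
    1 / 2 * ‖(1 / 2 : ℝ) • a + (1 / 2 : ℝ) • b - u‖ ^ 2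
      = 1 / 2 * (1 / 2 * ‖a - u‖ ^ 2) + 1 / 2 * (1 / 2 * ‖b - u‖ ^ 2) - 1 / 8 * ‖a - b‖ ^ 2 := by
  have h₁ : (1 / 2 : ℝ) • a + (1 / 2 : ℝ) • b - u = (1 / 2 : ℝ) • ((a - u) + (b - u)) := by module
  have h₂ : a - b = (a - u) - (b - u) := by abel
  rw [h₁, h₂, norm_smul, mul_pow, norm_add_sq_real,
    norm_sub_sq_real (a - u) (b - u)]
  norm_num
  ring

/-- Existence of proximity points. -/
lemma IsGammaZero.exists_forall_le [CompleteSpace E] (hφ : IsGammaZero φ) {t : ℝ} (ht : 0 < t)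
    (u : E) : ∃ (p : E) (r : ℝ), φ p = r ∧ ∀ (z : E) (s : ℝ), φ z = s →
      1 / 2 * ‖p - u‖ ^ 2 + t * r ≤ 1 / 2 * ‖z - u‖ ^ 2 + t * s := by
  set S : Set ℝ := {c | ∃ (z : E) (s : ℝ), φ z = s ∧ c = 1 / 2 * ‖z - u‖ ^ 2 + t * s} with hS
  obtain ⟨z₀, r₀, hz₀⟩ := hφ.exists_real
  have hne : S.Nonempty := ⟨_, z₀, r₀, hz₀, rfl⟩
  obtain ⟨x₀, c, C, hC, hlow⟩ := hφ.exists_linear_lower_bound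
  have hbdd : BddBelow S := by
    -- The quadratic absorbs the linear lower bound: n²/2 - tCn ≥ -(tC)²/2 with n = ‖z - u‖.
    refine ⟨t * (c - C * ‖u - x₀‖) - (t * C) ^ 2 / 2, ?_⟩
    rintro _ ⟨z, s, hz, rfl⟩
    have h₁ := mul_le_mul_of_nonneg_left (hlow z s hz) ht.le
    have h₂ : ‖z - x₀‖ ≤ ‖z - u‖ + ‖u - x₀‖ := norm_sub_le_norm_sub_add_norm_sub _ _ _
    have h₃ := mul_le_mul_of_nonneg_left h₂ (mul_nonneg ht.le hC)
    nlinarith [sq_nonneg (‖z - u‖ - t * C)]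
  set M := sInf S with hM
  have hMle : ∀ (z : E) (s : ℝ), φ z ≤ s → M ≤ 1 / 2 * ‖z - u‖ ^ 2 + t * s := by
    intro z s hz
    obtain ⟨s', hs'⟩ := exists_coe_eq (hφ.ne_bot z) (ne_top_of_le_ne_top (EReal.coe_ne_top s) hz)
    have h₁ : M ≤ 1 / 2 * ‖z - u‖ ^ 2 + t * s' := csInf_le hbdd ⟨z, s', hs', rfl⟩
    have h₂ : s' ≤ s := by rw [hs'] at hz; exact_mod_cast hz
    have := mul_le_mul_of_nonneg_left h₂ ht.le
    linarith
  have hex : ∀ n : ℕ, ∃ (z : E) (s : ℝ), φ z = s ∧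
      1 / 2 * ‖z - u‖ ^ 2 + t * s < M + 1 / ((n : ℝ) + 1) := by
    intro n
    obtain ⟨_, ⟨z, s, hz, rfl⟩, hlt⟩ :=
      exists_lt_of_csInf_lt hne (lt_add_of_pos_right M (Nat.one_div_pos_of_nat (α := ℝ) (n := n)))
    exact ⟨z, s, hz, hlt⟩
  choose a s ha hlt using hex
  have h0 : Tendsto (fun n : ℕ => 1 / ((n : ℝ) + 1)) atTop (𝓝 0) :=
    tendsto_one_div_add_atTop_nhds_zero_nat
  have hdist : ∀ n k, ‖a n - a k‖ ^ 2 ≤ 4 * (1 / ((n : ℝ) + 1) + 1 / ((k : ℝ) + 1)) := by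
    intro n k
    -- The midpoint of two near-minimizers cannot go below the infimum M, which forces them close
    -- together.
    have hmid := hMle _ _ (hφ.convex_coe (ha n).le (ha k).le (a := 1 / 2) (b := 1 / 2)
      (by norm_num) (by norm_num) (by norm_num))
    rw [half_norm_sq_midpoint] at hmid
    have := hlt n
    have := hlt k
    nlinarith
  have hcauchy : CauchySeq a := by
    rw [Metric.cauchySeq_iff']
    intro ε hε
    obtain ⟨N, hN⟩ := (h0.eventually (gt_mem_nhds (show 0 < ε ^ 2 / 8 by positivity))).exists_forall_of_atTop
    refine ⟨N, fun n hn => ?_⟩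
    rw [dist_eq_norm]
    have h₁ := hdist n N
    have h₂ := hN n hn
    have h₃ := hN N le_rfl
    exact lt_of_pow_lt_pow_left₀ 2 hε.le (by linarith)
  obtain ⟨p, hp⟩ := cauchySeq_tendsto_of_complete hcauchy
  have hbound : ∀ n, φ (a n) ≤ (((M + 1 / ((n : ℝ) + 1) - 1 / 2 * ‖a n - u‖ ^ 2) / t : ℝ) : EReal) := by
    intro n
    rw [ha n, EReal.coe_le_coe_iff, le_div_iff₀ ht]
    have := hlt n
    linarith
  have hlim : Tendsto (fun n : ℕ => (M + 1 / ((n : ℝ) + 1) - 1 / 2 * ‖a n - u‖ ^ 2) / t) atTop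
      (𝓝 ((M + 0 - 1 / 2 * ‖p - u‖ ^ 2) / t)) :=
    (((tendsto_const_nhds.add h0).sub
      (((hp.sub tendsto_const_nhds).norm.pow 2).const_mul _)).div_const _)
  have hple := hφ.le_of_tendsto hp hlim hbound
  obtain ⟨r, hr⟩ := exists_coe_eq (hφ.ne_bot p) (ne_top_of_le_ne_top (EReal.coe_ne_top _) hple)
  refine ⟨p, r, hr, fun z s hz => ?_⟩
  rw [hr, EReal.coe_le_coe_iff, le_div_iff₀ ht] at hple
  have := hMle z s hz.le
  linarith

lemma isProxPoint_of_forall_real {t : ℝ} (ht : 0 < t) {u p : E} {r : ℝ}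
    (hbot : ∀ z, φ z ≠ ⊥) (hp : φ p = r)
    (h : ∀ (z : E) (s : ℝ), φ z = s →
      1 / 2 * ‖p - u‖ ^ 2 + t * r ≤ 1 / 2 * ‖z - u‖ ^ 2 + t * s) : IsProxPoint t φ u p := by
  intro z _
  by_cases hz : φ z = ⊤
  · simp only [mem_ofPred_eq, hz, EReal.coe_mul_top_of_pos ht, EReal.coe_add_top, le_top]
  · obtain ⟨s, hs⟩ := exists_coe_eq (hbot z) hz
    simp only [mem_ofPred_eq, hp, hs]
    exact_mod_cast h z s hs

lemma IsProxPoint.exists_real {t : ℝ} (ht : 0 < t) {u p : E} (hbot : ∀ z, φ z ≠ ⊥)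
    (htop : ∃ z, φ z ≠ ⊤) (hp : IsProxPoint t φ u p) :
    ∃ r : ℝ, φ p = r ∧ ∀ (z : E) (s : ℝ), φ z = s →
      1 / 2 * ‖p - u‖ ^ 2 + t * r ≤ 1 / 2 * ‖z - u‖ ^ 2 + t * s := by
  obtain ⟨z₀, hz₀⟩ := htop
  obtain ⟨s₀, hs₀⟩ := exists_coe_eq (hbot z₀) hz₀
  have hptop : φ p ≠ ⊤ := by
    intro hpt
    have := hp (mem_univ z₀)
    simp only [mem_ofPred_eq, hpt, hs₀, EReal.coe_mul_top_of_pos ht, EReal.coe_add_top,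
      top_le_iff] at this
    exact EReal.coe_ne_top _ (by exact_mod_cast this)
  obtain ⟨r, hr⟩ := exists_coe_eq (hbot p) hptop
  refine ⟨r, hr, fun z s hz => ?_⟩
  have := hp (mem_univ z)
  simp only [mem_ofPred_eq, hr, hz] at this
  exact_mod_cast this

/-- Fermat's rule: compare p with εz + (1 - ε)p, divide by ε and let ε → 0. -/
lemma IsGammaZero.mem_subdiff_of_isProxPoint (hφ : IsGammaZero φ) {t : ℝ} (ht : 0 < t) {u p : E}
    (hp : IsProxPoint t φ u p) : t⁻¹ • (u - p) ∈ subdiff φ p := by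
  obtain ⟨r, hr, hmin⟩ := hp.exists_real ht hφ.ne_bot hφ.exists_ne_top
  refine mem_subdiff_of_forall_real hφ.ne_bot hr fun z s hz => ?_
  have key : ∀ ε : ℝ, 0 < ε → ε < 1 →
      t * r + inner ℝ (u - p) (z - p) ≤ t * s + ε * (1 / 2 * ‖z - p‖ ^ 2) := by
    intro ε h0 h1
    have hc := hφ.convex_coe hz.le hr.le h0 (sub_pos.2 h1) (by ring)
    obtain ⟨s', hs'⟩ := exists_coe_eq (hφ.ne_bot _) (ne_top_of_le_ne_top (EReal.coe_ne_top _) hc)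
    have hm := hmin _ s' hs'
    rw [hs', EReal.coe_le_coe_iff] at hc
    have hc' := mul_le_mul_of_nonneg_left hc ht.le
    rw [show ε • z + (1 - ε) • p - u = ε • (z - p) - (u - p) by module,
      norm_sub_sq_real (ε • (z - p)), norm_smul, mul_pow, Real.norm_of_nonneg h0.le, real_inner_smul_left, norm_sub_rev u p,
      real_inner_comm] at hm
    have : ε * (t * r + inner ℝ (u - p) (z - p)) ≤ ε * (t * s + ε * (1 / 2 * ‖z - p‖ ^ 2)) := by
      nlinarith
    exact le_of_mul_le_mul_left this h0
  have hlim : t * r + inner ℝ (u - p) (z - p) ≤ t * s := by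
    have htend : Tendsto (fun ε : ℝ => t * s + ε * (1 / 2 * ‖z - p‖ ^ 2)) (𝓝[>] 0)
        (𝓝 (t * s + 0 * (1 / 2 * ‖z - p‖ ^ 2))) :=
      (((continuous_id.mul continuous_const).const_add (t * s)).tendsto 0).mono_left
        nhdsWithin_le_nhds
    rw [zero_mul, add_zero] at htend
    refine ge_of_tendsto htend ?_
    filter_upwards [Ioo_mem_nhdsGT (show (0 : ℝ) < 1 by norm_num)] with ε hε
    exact key ε hε.1 hε.2
  rw [real_inner_smul_left]
  refine le_of_mul_le_mul_left ?_ ht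
  rw [mul_add, mul_inv_cancel_left₀ ht.ne']
  exact hlim

lemma IsGammaZero.mem_subdiff_prox [CompleteSpace E] (hφ : IsGammaZero φ) {t : ℝ} (ht : 0 < t)
    (u : E) : t⁻¹ • (u - prox t φ u) ∈ subdiff φ (prox t φ u) := by
  obtain ⟨p, r, hr, hmin⟩ := hφ.exists_forall_le ht u
  exact hφ.mem_subdiff_of_isProxPoint ht
    (Classical.epsilon_spec ⟨p, isProxPoint_of_forall_real ht hφ.ne_bot hr hmin⟩)

lemma IsGammaZero.fenchelConj_ne_bot (hφ : IsGammaZero φ) (y : E) : fenchelConj φ y ≠ ⊥ := by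
  obtain ⟨x, r, hr⟩ := hφ.exists_real
  refine ne_bot_of_le_ne_bot ?_ (le_iSup (fun x => ((inner ℝ x y : ℝ) : EReal) - φ x) x)
  simp only [hr, ← EReal.coe_sub]
  exact EReal.coe_ne_bot _

/-- The equality case of the Fenchel-Young inequality. -/
lemma IsGammaZero.fenchelConj_eq (hφ : IsGammaZero φ) {x v : E} {r : ℝ} (hv : v ∈ subdiff φ x)
    (hr : φ x = r) : fenchelConj φ v = ((inner ℝ x v - r : ℝ) : EReal) := by
  refine le_antisymm (iSup_le fun z => ?_) ?_
  · by_cases hz : φ z = ⊤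
    · rw [hz, EReal.sub_top]; exact bot_le
    · obtain ⟨s, hs⟩ := exists_coe_eq (hφ.ne_bot z) hz
      have := inner_add_le_of_mem_subdiff hv hr hs.le
      rw [hs, ← EReal.coe_sub, EReal.coe_le_coe_iff, real_inner_comm, real_inner_comm v x]
      rw [inner_sub_right] at this
      linarith
  · refine le_trans ?_ (le_iSup (fun x => ((inner ℝ x v : ℝ) : EReal) - φ x) x)
    rw [hr, EReal.coe_sub]

/-- Moreau's decomposition: the proximity operator of the conjugate in terms of the
subdifferential of the function itself. -/
lemma IsGammaZero.prox_fenchelConj_mem_subdiff [CompleteSpace E] (hφ : IsGammaZero φ) {t : ℝ}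
    (ht : 0 < t) (v : E) :
    prox t (fenchelConj φ) v ∈ subdiff φ (t⁻¹ • (v - prox t (fenchelConj φ) v)) := by
  set q := prox t⁻¹ φ (t⁻¹ • v) with hq
  have hsub := hφ.mem_subdiff_prox (inv_pos.2 ht) (t⁻¹ • v)
  rw [← hq, inv_inv] at hsub
  -- Moreau's formula supplies the candidate w. Fenchel-Young shows that it minimizes with a
  -- quadratic margin, so the minimizer is unique and the choice made by `prox` must be w;
  -- `fenchelConj φ` need not be shown to lie in Γ₀.
  set w := t • (t⁻¹ • v - q) with hw
  have hvw : v - w = t • q := by rw [hw, smul_sub, smul_inv_smul₀ ht.ne']; abel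
  obtain ⟨r, hr⟩ := hφ.exists_real_of_mem_subdiff hsub
  have hconj := hφ.fenchelConj_eq hsub hr
  have hstrong : ∀ (z : E) (s : ℝ), fenchelConj φ z = s →
      1 / 2 * ‖w - v‖ ^ 2 + t * (inner ℝ q w - r) + 1 / 2 * ‖z - w‖ ^ 2
        ≤ 1 / 2 * ‖z - v‖ ^ 2 + t * s := by
    intro z s hz
    have h₁ : inner ℝ q z - r ≤ s := by
      have := le_iSup (fun x => ((inner ℝ x z : ℝ) : EReal) - φ x) q
      rw [hr] at this
      have h₂ : ((inner ℝ q z - r : ℝ) : EReal) ≤ (s : EReal) := by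
        rw [← hz, EReal.coe_sub]; exact this
      exact_mod_cast h₂
    have h₂ : ‖z - v‖ ^ 2 = ‖z - w‖ ^ 2 - 2 * (t * (inner ℝ q z - inner ℝ q w)) + ‖w - v‖ ^ 2 := by
      rw [show z - v = (z - w) - (v - w) by abel, norm_sub_sq_real, norm_sub_rev v w, hvw,
        real_inner_smul_right, real_inner_comm, inner_sub_right]
    rw [h₂]
    nlinarith
  have hwprox : IsProxPoint t (fenchelConj φ) v w :=
    isProxPoint_of_forall_real ht hφ.fenchelConj_ne_bot hconj fun z s hz =>
      (le_add_of_nonneg_right (by positivity)).trans (hstrong z s hz)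
  have hprox : IsProxPoint t (fenchelConj φ) v (prox t (fenchelConj φ) v) :=
    Classical.epsilon_spec ⟨w, hwprox⟩
  obtain ⟨s, hs, hmin⟩ := hprox.exists_real ht hφ.fenchelConj_ne_bot
    ⟨w, by rw [hconj]; exact EReal.coe_ne_top _⟩
  have heq : prox t (fenchelConj φ) v = w := by
    have h₁ := hstrong _ s hs
    have h₂ := hmin w _ hconj
    have h₃ : ‖prox t (fenchelConj φ) v - w‖ ^ 2 ≤ 0 := by linarith
    exact sub_eq_zero.1 (norm_eq_zero.1 (pow_eq_zero_iff two_ne_zero |>.1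
      (le_antisymm h₃ (sq_nonneg _))))
  rw [heq, hvw, inv_smul_smul₀ ht.ne']
  exact hsub

end Convex

/-! ### Convex functions with Lipschitz gradient -/

section Smooth

variable {H : Type*} [NormedAddCommGroup H] [InnerProductSpace ℝ H] [CompleteSpace H]
  {f : H → ℝ}

lemma hasDerivAt_comp_line (hf : Differentiable ℝ f) (x d : H) (t : ℝ) :
    HasDerivAt (fun t : ℝ => f (x + t • d)) (inner ℝ (gradient f (x + t • d)) d) t := by
  have h₁ : HasDerivAt (fun t : ℝ => x + t • d) d t := by
    simpa using ((hasDerivAt_id t).smul_const d).const_add x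
  have h₂ := (hf (x + t • d)).hasGradientAt.hasFDerivAt
  have h₃ := h₂.comp_hasDerivAt t h₁
  rwa [toDual_apply_apply] at h₃

lemma inner_gradient_le_sub (hc : ConvexOn ℝ univ f) (hf : Differentiable ℝ f) (x y : H) :
    f x + inner ℝ (gradient f x) (y - x) ≤ f y := by
  have hline : ConvexOn ℝ univ (fun t : ℝ => f (x + t • (y - x))) := by
    refine ⟨convex_univ, fun s _ t _ a b ha hb hab => ?_⟩
    have := hc.2 (mem_univ (x + s • (y - x))) (mem_univ (x + t • (y - x))) ha hb hab
    have hx : x + (a • s + b • t) • (y - x)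
        = a • (x + s • (y - x)) + b • (x + t • (y - x)) := by
      calc x + (a • s + b • t) • (y - x)
          = (a + b) • x + (a • s + b • t) • (y - x) := by rw [hab, one_smul]
        _ = _ := by simp only [smul_eq_mul]; module
    simp only [hx]
    exact this
  have h := hline.le_slope_of_hasDerivAt (mem_univ 0) (mem_univ 1) one_pos
    (hasDerivAt_comp_line hf x (y - x) 0)
  rw [slope_def_field, zero_smul, one_smul, add_zero, add_sub_cancel, sub_zero, div_one] at h
  linarith

/-- The descent lemma. -/
lemma le_add_inner_gradient (hf : Differentiable ℝ f) {L : ℝ}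
    (hl : ∀ a b : H, ‖gradient f a - gradient f b‖ ≤ L * ‖a - b‖) (x y : H) :
    f y ≤ f x + inner ℝ (gradient f x) (y - x) + L / 2 * ‖y - x‖ ^ 2 := by
  set d := y - x with hd
  have hder : ∀ t : ℝ, HasDerivAt
      (fun t : ℝ => f (x + t • d) - t * inner ℝ (gradient f x) d - L / 2 * ‖d‖ ^ 2 * t ^ 2)
      (inner ℝ (gradient f (x + t • d)) d - inner ℝ (gradient f x) d - L * ‖d‖ ^ 2 * t) t := by
    intro t
    have h₁ := ((hasDerivAt_id t).mul_const (inner ℝ (gradient f x) d))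
    have h₂ := ((hasDerivAt_id t).pow 2).const_mul (L / 2 * ‖d‖ ^ 2)
    refine (((hasDerivAt_comp_line hf x d t).sub h₁).sub h₂).congr_deriv ?_
    norm_num
    ring
  -- The Lipschitz bound makes the derivative nonpositive for t > 0; the claim compares t = 0 with t
  -- = 1.
  have hanti : AntitoneOn
      (fun t : ℝ => f (x + t • d) - t * inner ℝ (gradient f x) d - L / 2 * ‖d‖ ^ 2 * t ^ 2)
      (Ici 0) := by
    refine antitoneOn_of_deriv_nonpos (convex_Ici 0)
      (fun t _ => (hder t).continuousAt.continuousWithinAt)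
      (fun t _ => (hder t).differentiableAt.differentiableWithinAt) fun t ht => ?_
    rw [interior_Ici, mem_Ioi] at ht
    rw [(hder t).deriv, ← inner_sub_left]
    have h₁ := real_inner_le_norm (gradient f (x + t • d) - gradient f x) d
    have h₂ := hl (x + t • d) x
    rw [add_sub_cancel_left, norm_smul, Real.norm_of_nonneg ht.le] at h₂
    have h₃ := mul_le_mul_of_nonneg_right h₂ (norm_nonneg d)
    nlinarith
  have := hanti (mem_Ici.2 le_rfl) (mem_Ici.2 zero_le_one) zero_le_one
  simp only [one_smul, zero_smul, add_zero, zero_mul, one_mul] at this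
  rw [show x + d = y by rw [hd]; abel] at this
  linarith

/-- Estimate f at y - L⁻¹(∇f(y) - ∇f(x)) twice: from below by the tangent at x, from above by the
descent lemma at y. -/
lemma add_norm_sub_sq_gradient_le (hc : ConvexOn ℝ univ f) (hf : Differentiable ℝ f) {L : ℝ}
    (hL : 0 < L) (hl : ∀ a b : H, ‖gradient f a - gradient f b‖ ≤ L * ‖a - b‖) (x y : H) :
    f x + inner ℝ (gradient f x) (y - x) + 1 / (2 * L) * ‖gradient f y - gradient f x‖ ^ 2
      ≤ f y := by
  set e := gradient f y - gradient f x with he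
  have h₁ := inner_gradient_le_sub hc hf x (y - L⁻¹ • e)
  have h₂ := le_add_inner_gradient hf hl y (y - L⁻¹ • e)
  rw [show y - L⁻¹ • e - x = (y - x) - L⁻¹ • e by abel, inner_sub_right,
    real_inner_smul_right] at h₁
  rw [show y - L⁻¹ • e - y = -(L⁻¹ • e) by abel, inner_neg_right, real_inner_smul_right,
    norm_neg, norm_smul, mul_pow, Real.norm_of_nonneg (inv_pos.2 hL).le] at h₂
  have h₃ : inner ℝ (gradient f y) e = inner ℝ (gradient f x) e + ‖e‖ ^ 2 := by
    rw [← real_inner_self_eq_norm_sq, ← inner_add_left, he]; congr 1; abel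
  rw [h₃] at h₂
  have h₄ : L / 2 * (L⁻¹ ^ 2 * ‖e‖ ^ 2) = 1 / (2 * L) * ‖e‖ ^ 2 := by field_simp
  have h₅ : L⁻¹ * ‖e‖ ^ 2 = 2 * (1 / (2 * L) * ‖e‖ ^ 2) := by field_simp
  rw [h₄, mul_add, h₅] at h₂
  linarith

/-- The Baillon-Haddad theorem: a Lipschitz continuous gradient of a convex function is
cocoercive. -/
lemma gradient_cocoercive (hc : ConvexOn ℝ univ f) (hf : Differentiable ℝ f) {L : ℝ}
    (hL : 0 < L) (hl : ∀ a b : H, ‖gradient f a - gradient f b‖ ≤ L * ‖a - b‖) (x y : H) :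
    1 / L * ‖gradient f x - gradient f y‖ ^ 2 ≤ inner ℝ (gradient f x - gradient f y) (x - y) := by
  have h₁ := add_norm_sub_sq_gradient_le hc hf hL hl x y
  have h₂ := add_norm_sub_sq_gradient_le hc hf hL hl y x
  rw [norm_sub_rev] at h₁
  rw [← neg_sub x y, inner_neg_right] at h₁
  rw [inner_sub_left]
  have : 1 / L * ‖gradient f x - gradient f y‖ ^ 2
      = 2 * (1 / (2 * L) * ‖gradient f x - gradient f y‖ ^ 2) := by field_simp
  linarith

end Smooth

/-! ### Weak limits along ultrafilters -/

section Weak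

variable {E : Type*} [NormedAddCommGroup E] [InnerProductSpace ℝ E]

lemma exists_tendsto_of_abs_le {ι : Type*} (U : Ultrafilter ι) {a : ι → ℝ} {C : ℝ}
    (ha : ∀ i, |a i| ≤ C) : ∃ c, |c| ≤ C ∧ Tendsto a U (𝓝 c) := by
  obtain ⟨c, hc, hle⟩ := isCompact_Icc.ultrafilter_le_nhds (U.map a)
    (le_principal_iff.2 (Filter.mem_map.2 (Eventually.of_forall fun i => abs_le.1 (ha i))))
  exact ⟨c, abs_le.2 hc, hle⟩

/-- Weak sequential compactness of bounded sets of a Hilbert space, in terms of ultrafilters. -/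
lemma exists_weak_limit [CompleteSpace E] {ι : Type*} (U : Ultrafilter ι) {a : ι → E} {C : ℝ}
    (ha : ∀ i, ‖a i‖ ≤ C) : ∃ x : E, ∀ v, Tendsto (fun i => inner ℝ (a i) v) U (𝓝 (inner ℝ x v)) := by
  have hex : ∀ v : E, ∃ c : ℝ, |c| ≤ C * ‖v‖ ∧ Tendsto (fun i => inner ℝ (a i) v) U (𝓝 c) :=
    fun v => exists_tendsto_of_abs_le U fun i =>
      (abs_real_inner_le_norm _ _).trans (mul_le_mul_of_nonneg_right (ha i) (norm_nonneg v))
  choose ℓ hℓ hlim using hex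
  -- The pointwise limits form a linear functional bounded by C, which the Riesz theorem represents
  -- by a vector.
  let F : E →ₗ[ℝ] ℝ :=
    { toFun := ℓ
      map_add' := fun v w => tendsto_nhds_unique (hlim (v + w)) (by
        simpa only [inner_add_right] using (hlim v).add (hlim w))
      map_smul' := fun c v => tendsto_nhds_unique (hlim (c • v)) (by
        simpa only [real_inner_smul_right, RingHom.id_apply, smul_eq_mul] using
          (hlim v).const_mul c) }
  refine ⟨(toDual ℝ E).symm (F.mkContinuous C hℓ), fun v => ?_⟩
  rw [toDual_symm_apply]
  exact hlim v

lemma tendsto_inner_of_weak_of_strong {ι : Type*} {l : Filter ι} {a b : ι → E} {x z : E} {C : ℝ}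
    (hC : ∀ i, ‖a i‖ ≤ C) (ha : ∀ v, Tendsto (fun i => inner ℝ (a i) v) l (𝓝 (inner ℝ x v)))
    (hb : Tendsto b l (𝓝 z)) : Tendsto (fun i => inner ℝ (a i) (b i)) l (𝓝 (inner ℝ x z)) := by
  have h₁ : Tendsto (fun i => inner ℝ (a i) (b i - z)) l (𝓝 0) := by
    have h₂ : Tendsto (fun i => C * ‖b i - z‖) l (𝓝 (C * ‖z - z‖)) :=
      ((hb.sub tendsto_const_nhds).norm).const_mul C
    rw [sub_self, norm_zero, mul_zero] at h₂
    exact squeeze_zero_norm (fun i => (norm_inner_le_norm _ _).trans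
      (mul_le_mul_of_nonneg_right (hC i) (norm_nonneg _))) h₂
  have h₃ := h₁.add (ha z)
  rw [zero_add] at h₃
  refine h₃.congr fun i => ?_
  rw [← inner_add_right, sub_add_cancel]

lemma weak_tendsto_of_sub {ι : Type*} {l : Filter ι} {a b : ι → E} {x : E}
    (ha : ∀ v, Tendsto (fun i => inner ℝ (a i) v) l (𝓝 (inner ℝ x v)))
    (hb : Tendsto (fun i => b i - a i) l (𝓝 0)) :
    ∀ v, Tendsto (fun i => inner ℝ (b i) v) l (𝓝 (inner ℝ x v)) := by
  intro v
  have h := (hb.inner (𝕜 := ℝ) (tendsto_const_nhds (x := v))).add (ha v)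
  rw [inner_zero_left, zero_add] at h
  refine h.congr fun i => ?_
  rw [← inner_add_left, sub_add_cancel]

/-- Functions in `Γ₀` are weakly lower semicontinuous. -/
lemma IsGammaZero.eventually_lt_of_weak [CompleteSpace E] {φ : E → EReal} (hφ : IsGammaZero φ)
    {ι : Type*} {U : Ultrafilter ι} {a : ι → E} {x : E}
    (ha : ∀ v, Tendsto (fun i => inner ℝ (a i) v) U (𝓝 (inner ℝ x v))) {c : ℝ} (hc : c < φ x) :
    ∀ᶠ i in (U : Filter ι), (c : EReal) < φ (a i) := by
  by_contra hnot
  -- For an ultrafilter the negation holds eventually, so the points lie in a closed convex sublevel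
  -- set; Hahn-Banach separates x from it, against weak convergence.
  have hle : ∀ᶠ i in (U : Filter ι), φ (a i) ≤ c := by
    simpa only [not_lt] using Ultrafilter.eventually_not.2 hnot
  have hconv : Convex ℝ {z | φ z ≤ c} := by
    refine convex_iff_forall_pos.2 fun y hy z hz s t hs ht hst => ?_
    have := hφ.convex_coe hy hz hs ht hst
    rwa [← add_mul, hst, one_mul] at this
  have hclosed : IsClosed {z | φ z ≤ c} := hφ.lsc.isClosed_preimage _
  obtain ⟨F, s, h₁, h₂⟩ := geometric_hahn_banach_closed_point hconv hclosed (x := x)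
    (by simpa using hc)
  have hF : ∀ z, F z = inner ℝ z ((toDual ℝ E).symm F) := fun z => by
    rw [real_inner_comm, toDual_symm_apply]
  have hlim := ha ((toDual ℝ E).symm F)
  simp only [← hF] at hlim
  exact absurd (_root_.le_of_tendsto hlim (hle.mono fun i hi => (h₁ _ hi).le)) (not_le.2 h₂)

end Weak

/-! ### The iteration with a single dual block -/

section PrimalDual

variable {H K : Type*} [NormedAddCommGroup H] [InnerProductSpace ℝ H] [CompleteSpace H]
  [NormedAddCommGroup K] [InnerProductSpace ℝ K] [CompleteSpace K]

local notation "adj" => ContinuousLinearMap.adjoint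

/-- The Karush-Kuhn-Tucker conditions for `min f + g + h ∘ B`. -/
structure IsKKT (f : H → ℝ) (g : H → EReal) (h : K → EReal) (B : H →L[ℝ] K) (p : H) (q : K) :
    Prop where
  primal : -gradient f p - adj B q ∈ subdiff g p
  dual : q ∈ subdiff h (B p)

/-- The inclusions satisfied by the iterates of the dual forward-backward algorithm with one inner
iteration; `w k` is the predicted primal point. -/
structure IsPrimalDualSeq (f : H → ℝ) (g : H → EReal) (h : K → EReal) (B : H →L[ℝ] K)
    (γ lam : ℝ) (x w : ℕ → H) (y : ℕ → K) : Prop where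
  primal : ∀ k, γ⁻¹ • (x k - γ • gradient f (x k) - γ • adj B (y (k + 1)) - x (k + 1))
    ∈ subdiff g (x (k + 1))
  predict : ∀ k, γ⁻¹ • (x k - γ • gradient f (x k) - γ • adj B (y k) - w k) ∈ subdiff g (w k)
  dual : ∀ k, y (k + 1) ∈ subdiff h ((γ / lam) • (y k - y (k + 1)) + B (w k))

-- Algebraic core of the Fejér estimate. The terms in s cancel around the cycle, and completing the
-- square in W - P costs only γ²‖b' - b‖².
omit [CompleteSpace H] in
lemma norm_sq_add_le_of_inner_le {U P W b b' s : H} {γ : ℝ}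
    (h : inner ℝ (U - γ • b' - P - s) (-P) + inner ℝ (-s) W
      + inner ℝ (U - γ • b - W - s) (P - W) ≤ 0) :
    ‖P‖ ^ 2 + ‖U - W‖ ^ 2 + ‖W - P - γ • (b' - b)‖ ^ 2 + 2 * γ * inner ℝ b' W
      ≤ ‖U‖ ^ 2 + γ ^ 2 * ‖b' - b‖ ^ 2 := by
  have h₁ : ‖W - P - γ • (b' - b)‖ ^ 2
      = ‖W - P‖ ^ 2 - 2 * (γ * inner ℝ (W - P) (b' - b)) + γ ^ 2 * ‖b' - b‖ ^ 2 := by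
    rw [norm_sub_sq_real, real_inner_smul_right, norm_smul, mul_pow, Real.norm_eq_abs, sq_abs]
  rw [h₁, norm_sub_sq_real U W, norm_sub_sq_real W P]
  simp only [inner_sub_left, inner_sub_right, inner_neg_left, inner_neg_right,
    real_inner_smul_left, real_inner_self_eq_norm_sq] at h ⊢
  rw [real_inner_comm P W, real_inner_comm b' W, real_inner_comm b' P, real_inner_comm b W,
    real_inner_comm b P] at *
  linarith

lemma tendsto_zero_of_add_le {V E : ℕ → ℝ} (hV : ∀ k, 0 ≤ V k) (hE : ∀ k, 0 ≤ E k)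
    (h : ∀ k, V (k + 1) + E k ≤ V k) : (∃ l, Tendsto V atTop (𝓝 l)) ∧ Tendsto E atTop (𝓝 0) := by
  have hanti : Antitone V := antitone_nat_of_succ_le fun k => by linarith [h k, hE k]
  have hlim := tendsto_atTop_ciInf hanti ⟨0, by rintro _ ⟨k, rfl⟩; exact hV k⟩
  refine ⟨⟨_, hlim⟩, ?_⟩
  have hd := hlim.sub (hlim.comp (tendsto_add_atTop_nat 1))
  rw [sub_self] at hd
  exact squeeze_zero hE (fun k => by simp only [Function.comp_apply]; linarith [h k]) hd

lemma tendsto_zero_of_norm_sq {E : Type*} [NormedAddCommGroup E] {a : ℕ → E} {c : ℝ} (hc : 0 < c)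
    {e : ℕ → ℝ} (he : Tendsto e atTop (𝓝 0)) (h : ∀ k, c * ‖a k‖ ^ 2 ≤ e k) :
    Tendsto a atTop (𝓝 0) := by
  have h₁ : Tendsto (fun k => c * ‖a k‖ ^ 2) atTop (𝓝 0) :=
    squeeze_zero (fun k => by positivity) h he
  have h₂ := (h₁.const_mul c⁻¹).sqrt
  simp only [inv_mul_cancel_left₀ hc.ne', mul_zero, Real.sqrt_zero,
    Real.sqrt_sq (norm_nonneg _)] at h₂
  exact tendsto_zero_iff_norm_tendsto_zero.2 h₂

variable {f : H → ℝ} {g : H → EReal} {h : K → EReal} {B : H →L[ℝ] K} {γ lam L : ℝ}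
  {x w : ℕ → H} {y : ℕ → K}

/-- The weight γ²/λ on the dual part is chosen so that the cross term 2γ⟨b', w_k - p⟩ from ∂g
cancels the one from ∂h. -/
lemma IsPrimalDualSeq.fejer (hs : IsPrimalDualSeq f g h B γ lam x w y)
    (hfc : ConvexOn ℝ univ f) (hfd : Differentiable ℝ f) (hL : 0 < L)
    (hl : ∀ a b : H, ‖gradient f a - gradient f b‖ ≤ L * ‖a - b‖)
    (hg : IsGammaZero g) (hh : IsGammaZero h) (hγ : 0 < γ) (hlam : 0 < lam)
    {p : H} {q : K} (hpq : IsKKT f g h B p q) (k : ℕ) :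
    (‖x (k + 1) - p‖ ^ 2 + γ ^ 2 / lam * ‖y (k + 1) - q‖ ^ 2)
      + (γ * (2 / L - γ) * ‖gradient f (x k) - gradient f p‖ ^ 2
        + ‖x k - w k - γ • (gradient f (x k) - gradient f p)‖ ^ 2
        + γ ^ 2 / lam * (1 - lam * ‖B‖ ^ 2) * ‖y (k + 1) - y k‖ ^ 2)
      ≤ ‖x k - p‖ ^ 2 + γ ^ 2 / lam * ‖y k - q‖ ^ 2 := by
  have hcyc := hg.subdiff_cyclic (hs.primal k) hpq.primal (hs.predict k)
  have hmono := hh.inner_subdiff_nonneg (hs.dual k) hpq.dual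
  have hcoc := gradient_cocoercive hfc hfd hL hl (x k) p
  set D := gradient f (x k) - gradient f p with hD
  set b := adj B (y k - q) with hb
  set b' := adj B (y (k + 1) - q) with hb'
  -- The cyclic inequality, multiplied by γ and translated so that p is the origin; -s is γ times
  -- the subgradient at p.
  have hcyc' := norm_sq_add_le_of_inner_le (U := x k - p - γ • D) (P := x (k + 1) - p)
    (W := w k - p) (b := b) (b' := b') (s := γ • gradient f p + γ • adj B q) (γ := γ) (by
      have h₁ : x k - p - γ • D - γ • b' - (x (k + 1) - p) - (γ • gradient f p + γ • adj B q)
          = x k - γ • gradient f (x k) - γ • adj B (y (k + 1)) - x (k + 1) := by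
        rw [hD, hb', map_sub]; module
      have h₂ : x k - p - γ • D - γ • b - (w k - p) - (γ • gradient f p + γ • adj B q)
          = x k - γ • gradient f (x k) - γ • adj B (y k) - w k := by
        rw [hD, hb, map_sub]; module
      have h₃ : -(γ • gradient f p + γ • adj B q) = γ • (-gradient f p - adj B q) := by module
      rw [h₁, h₂, h₃, neg_sub, sub_sub_sub_cancel_right, real_inner_smul_left]
      rw [real_inner_smul_left, real_inner_smul_left] at hcyc
      have := mul_le_mul_of_nonneg_left hcyc hγ.le
      rwa [mul_zero, mul_add, mul_add, mul_inv_cancel_left₀ hγ.ne',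
        mul_inv_cancel_left₀ hγ.ne'] at this)
  have hdual : γ ^ 2 / lam * ‖y (k + 1) - q‖ ^ 2 + γ ^ 2 / lam * ‖y (k + 1) - y k‖ ^ 2
      ≤ γ ^ 2 / lam * ‖y k - q‖ ^ 2 + 2 * γ * inner ℝ b' (w k - p) := by
    have h₁ : (γ / lam) • (y k - y (k + 1)) + B (w k) - B p
        = (γ / lam) • (y k - y (k + 1)) + B (w k - p) := by rw [map_sub]; abel
    have h₂ : ‖y k - q‖ ^ 2 = ‖y (k + 1) - q‖ ^ 2
        + 2 * inner ℝ (y (k + 1) - q) (y k - y (k + 1)) + ‖y (k + 1) - y k‖ ^ 2 := by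
      rw [norm_sub_rev (y (k + 1)) (y k), ← norm_add_sq_real]; congr 2; abel
    rw [h₁, inner_add_right, real_inner_smul_right, ← ContinuousLinearMap.adjoint_inner_left,
      ← hb'] at hmono
    rw [h₂]
    have h₃ := mul_nonneg (mul_nonneg zero_le_two hγ.le) hmono
    have h₄ : 2 * γ * (γ / lam * inner ℝ (y (k + 1) - q) (y k - y (k + 1)) + inner ℝ b' (w k - p))
      = γ ^ 2 / lam * (2 * inner ℝ (y (k + 1) - q) (y k - y (k + 1)))
        + 2 * γ * inner ℝ b' (w k - p) := by ring
    rw [h₄] at h₃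
    linarith
  have hnorm : γ ^ 2 * ‖b' - b‖ ^ 2 ≤ γ ^ 2 / lam * (lam * ‖B‖ ^ 2 * ‖y (k + 1) - y k‖ ^ 2) := by
    have h₁ : b' - b = adj B (y (k + 1) - y k) := by
      rw [hb, hb', ← map_sub]; congr 1; abel
    have h₂ := (adj B).le_opNorm (y (k + 1) - y k)
    rw [LinearIsometryEquiv.norm_map] at h₂
    have h₃ := pow_le_pow_left₀ (norm_nonneg _) h₂ 2
    rw [← h₁, mul_pow] at h₃
    calc γ ^ 2 * ‖b' - b‖ ^ 2 ≤ γ ^ 2 * (‖B‖ ^ 2 * ‖y (k + 1) - y k‖ ^ 2) :=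
          mul_le_mul_of_nonneg_left h₃ (sq_nonneg γ)
      _ = _ := by field_simp
  have hU : ‖x k - p - γ • D‖ ^ 2 ≤ ‖x k - p‖ ^ 2 - γ * (2 / L - γ) * ‖D‖ ^ 2 := by
    rw [norm_sub_sq_real, real_inner_smul_right, norm_smul, mul_pow, Real.norm_eq_abs, sq_abs,
      real_inner_comm]
    have := mul_le_mul_of_nonneg_left hcoc (mul_nonneg zero_le_two hγ.le)
    have h₁ : 2 * γ * (1 / L * ‖D‖ ^ 2) = γ * (2 / L) * ‖D‖ ^ 2 := by ring
    rw [h₁] at this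
    nlinarith
  have hUW : x k - p - γ • D - (w k - p) = x k - w k - γ • D := by abel
  rw [hUW] at hcyc'
  -- The completed square is discarded.
  have := sq_nonneg ‖w k - p - (x (k + 1) - p) - γ • (b' - b)‖
  linarith

lemma IsPrimalDualSeq.asymptotics (hs : IsPrimalDualSeq f g h B γ lam x w y)
    (hfc : ConvexOn ℝ univ f) (hfd : Differentiable ℝ f) (hL : 0 < L)
    (hl : ∀ a b : H, ‖gradient f a - gradient f b‖ ≤ L * ‖a - b‖)
    (hg : IsGammaZero g) (hh : IsGammaZero h) (hγ : 0 < γ) (hγL : γ < 2 / L) (hlam : 0 < lam)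
    (hB : lam * ‖B‖ ^ 2 < 1) {p : H} {q : K} (hpq : IsKKT f g h B p q) :
    (∃ l, Tendsto (fun k => ‖x k - p‖ ^ 2 + γ ^ 2 / lam * ‖y k - q‖ ^ 2) atTop (𝓝 l)) ∧
    Tendsto (fun k => gradient f (x k)) atTop (𝓝 (gradient f p)) ∧
    Tendsto (fun k => w k - x k) atTop (𝓝 0) ∧
    Tendsto (fun k => y (k + 1) - y k) atTop (𝓝 0) := by
  have hc₁ : 0 < γ * (2 / L - γ) := mul_pos hγ (sub_pos.2 hγL)
  have hc₂ : 0 < γ ^ 2 / lam * (1 - lam * ‖B‖ ^ 2) := mul_pos (by positivity) (sub_pos.2 hB)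
  obtain ⟨hV, hE⟩ := tendsto_zero_of_add_le
    (V := fun k => ‖x k - p‖ ^ 2 + γ ^ 2 / lam * ‖y k - q‖ ^ 2)
    (fun k => by positivity) (fun k => by positivity)
    (hs.fejer hfc hfd hL hl hg hh hγ hlam hpq)
  have h₁ : Tendsto (fun k => gradient f (x k) - gradient f p) atTop (𝓝 0) :=
    tendsto_zero_of_norm_sq hc₁ hE fun k => by
      have : 0 ≤ γ ^ 2 / lam * (1 - lam * ‖B‖ ^ 2) * ‖y (k + 1) - y k‖ ^ 2 := by positivity
      have := sq_nonneg ‖x k - w k - γ • (gradient f (x k) - gradient f p)‖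
      linarith
  have h₂ : Tendsto (fun k => x k - w k - γ • (gradient f (x k) - gradient f p)) atTop (𝓝 0) :=
    tendsto_zero_of_norm_sq one_pos hE fun k => by
      have : 0 ≤ γ ^ 2 / lam * (1 - lam * ‖B‖ ^ 2) * ‖y (k + 1) - y k‖ ^ 2 := by positivity
      have : 0 ≤ γ * (2 / L - γ) * ‖gradient f (x k) - gradient f p‖ ^ 2 := by positivity
      linarith
  have h₃ : Tendsto (fun k => y (k + 1) - y k) atTop (𝓝 0) :=
    tendsto_zero_of_norm_sq hc₂ hE fun k => by
      have : 0 ≤ γ * (2 / L - γ) * ‖gradient f (x k) - gradient f p‖ ^ 2 := by positivity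
      have := sq_nonneg ‖x k - w k - γ • (gradient f (x k) - gradient f p)‖
      linarith
  refine ⟨hV, tendsto_sub_nhds_zero_iff.1 h₁, ?_, h₃⟩
  have h₄ := (h₂.add (h₁.const_smul γ)).neg
  simp only [smul_zero, add_zero, neg_zero, sub_add_cancel, neg_sub] at h₄
  exact h₄

lemma IsPrimalDualSeq.bounded (hs : IsPrimalDualSeq f g h B γ lam x w y)
    (hfc : ConvexOn ℝ univ f) (hfd : Differentiable ℝ f) (hL : 0 < L)
    (hl : ∀ a b : H, ‖gradient f a - gradient f b‖ ≤ L * ‖a - b‖)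
    (hg : IsGammaZero g) (hh : IsGammaZero h) (hγ : 0 < γ) (hγL : γ < 2 / L) (hlam : 0 < lam)
    (hB : lam * ‖B‖ ^ 2 < 1) {p : H} {q : K} (hpq : IsKKT f g h B p q) :
    ∃ C, (∀ k, ‖x k‖ ≤ C) ∧ (∀ k, ‖w k‖ ≤ C) ∧ ∀ k, ‖y k‖ ≤ C := by
  obtain ⟨⟨l, hV⟩, -, hw, -⟩ := hs.asymptotics hfc hfd hL hl hg hh hγ hγL hlam hB hpq
  obtain ⟨M, hM⟩ := hV.bddAbove_range
  obtain ⟨N, hN⟩ := hw.norm.bddAbove_range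
  have hM' : ∀ k, ‖x k - p‖ ^ 2 + γ ^ 2 / lam * ‖y k - q‖ ^ 2 ≤ M := fun k => hM ⟨k, rfl⟩
  have hN' : ∀ k, ‖w k - x k‖ ≤ N := fun k => hN ⟨k, rfl⟩
  have hc : 0 < γ ^ 2 / lam := by positivity
  have hx : ∀ k, ‖x k‖ ≤ √M + ‖p‖ := fun k => by
    have h₁ : ‖x k - p‖ ≤ √M := Real.le_sqrt_of_sq_le (by
      have : 0 ≤ γ ^ 2 / lam * ‖y k - q‖ ^ 2 := by positivity
      linarith [hM' k])
    linarith [norm_le_norm_sub_add (x k) p]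
  have hy : ∀ k, ‖y k‖ ≤ √(M / (γ ^ 2 / lam)) + ‖q‖ := fun k => by
    have h₁ : ‖y k - q‖ ≤ √(M / (γ ^ 2 / lam)) := Real.le_sqrt_of_sq_le (by
      rw [le_div_iff₀ hc]
      linarith [hM' k, sq_nonneg ‖x k - p‖])
    linarith [norm_le_norm_sub_add (y k) q]
  have hw' : ∀ k, ‖w k‖ ≤ N + (√M + ‖p‖) := fun k =>
    (norm_le_norm_sub_add (w k) (x k)).trans (add_le_add (hN' k) (hx k))
  refine ⟨max (√M + ‖p‖) (max (N + (√M + ‖p‖)) (√(M / (γ ^ 2 / lam)) + ‖q‖)), fun k => ?_,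
    fun k => ?_, fun k => ?_⟩
  · exact (hx k).trans (le_max_left _ _)
  · exact (hw' k).trans ((le_max_left _ _).trans (le_max_right _ _))
  · exact (hy k).trans ((le_max_right _ _).trans (le_max_right _ _))

lemma exists_real_lt {c : EReal} (hc : c ≠ ⊥) : ∃ r : ℝ, (r : EReal) < c :=
  let ⟨r, _, hr⟩ := EReal.lt_iff_exists_real_btwn.1 (bot_lt_iff_ne_bot.2 hc)
  ⟨r, hr⟩

/-- Shows that g and h ∘ B are finite at a weak limit, where a priori only lower bounds are
available. -/
lemma exists_real_of_forall_add_le {a b : EReal} (ha : a ≠ ⊥) (hb : b ≠ ⊥) {R : ℝ}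
    (h : ∀ c d : ℝ, (c : EReal) < a → (d : EReal) < b → c + d ≤ R) : ∃ r : ℝ, a = r := by
  obtain ⟨d, hd⟩ := exists_real_lt hb
  refine exists_coe_eq ha fun htop => ?_
  have := h (R - d + 1) d (by rw [htop]; exact EReal.coe_lt_top _) hd
  linarith

/-- Weak cluster points of the iterates satisfy the Karush-Kuhn-Tucker conditions. -/
lemma IsPrimalDualSeq.isKKT_of_weak_limit (hs : IsPrimalDualSeq f g h B γ lam x w y)
    (hfc : ConvexOn ℝ univ f) (hfd : Differentiable ℝ f) (hL : 0 < L)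
    (hl : ∀ a b : H, ‖gradient f a - gradient f b‖ ≤ L * ‖a - b‖)
    (hg : IsGammaZero g) (hh : IsGammaZero h) (hγ : 0 < γ) (hγL : γ < 2 / L) (hlam : 0 < lam)
    (hB : lam * ‖B‖ ^ 2 < 1) {p₀ : H} {q₀ : K} (hpq : IsKKT f g h B p₀ q₀)
    {U : Ultrafilter ℕ} (hU : (U : Filter ℕ) ≤ atTop) {p : H} {q : K}
    (hxp : ∀ v, Tendsto (fun k => inner ℝ (x k) v) U (𝓝 (inner ℝ p v)))
    (hyq : ∀ v, Tendsto (fun k => inner ℝ (y k) v) U (𝓝 (inner ℝ q v))) :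
    IsKKT f g h B p q := by
  obtain ⟨-, hgrad, hw, hy⟩ := hs.asymptotics hfc hfd hL hl hg hh hγ hγL hlam hB hpq
  obtain ⟨C, hCx, hCw, hCy⟩ := hs.bounded hfc hfd hL hl hg hh hγ hγL hlam hB hpq
  replace hgrad := hgrad.mono_left hU
  replace hw := hw.mono_left hU
  replace hy := hy.mono_left hU
  -- Cocoercivity at x_k and p: x_k - p tends weakly to 0 and the gradients converge strongly, so
  -- the right-hand side vanishes in the limit.
  have hgradeq : gradient f p = gradient f p₀ := by
    have h₁ : Tendsto (fun k => inner ℝ (x k - p) (gradient f (x k) - gradient f p)) U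
        (𝓝 (inner ℝ (0 : H) (gradient f p₀ - gradient f p))) := by
      refine tendsto_inner_of_weak_of_strong (C := C + ‖p‖)
        (fun k => (norm_sub_le _ _).trans (add_le_add_left (hCx k) _)) (fun v => ?_)
        (hgrad.sub_const _)
      have := (hxp v).sub_const (inner ℝ p v)
      simpa only [inner_sub_left, sub_self, inner_zero_left] using this
    rw [inner_zero_left] at h₁
    have h₂ : Tendsto (fun k => 1 / L * ‖gradient f (x k) - gradient f p‖ ^ 2) U
        (𝓝 (1 / L * ‖gradient f p₀ - gradient f p‖ ^ 2)) :=
      (((hgrad.sub_const _).norm).pow 2).const_mul _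
    have h₃ := le_of_tendsto_of_tendsto' h₂ h₁ fun k => by
      rw [real_inner_comm]; exact gradient_cocoercive hfc hfd hL hl (x k) p
    have h₄ : ‖gradient f p₀ - gradient f p‖ ^ 2 ≤ 0 := by
      by_contra! hpos
      have : 0 < 1 / L * ‖gradient f p₀ - gradient f p‖ ^ 2 := by positivity
      linarith
    have h₅ := pow_eq_zero_iff two_ne_zero |>.1 (le_antisymm h₄ (sq_nonneg _))
    exact (sub_eq_zero.1 (norm_eq_zero.1 h₅)).symm
  rw [← hgradeq] at hgrad
  have hwp := weak_tendsto_of_sub hxp hw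
  have hyq' := weak_tendsto_of_sub hyq hy
  have hy' : Tendsto (fun k => y k - y (k + 1)) U (𝓝 0) := by
    simpa only [neg_sub, neg_zero] using hy.neg
  have hBw : ∀ v, Tendsto (fun k => inner ℝ (B (w k)) v) U (𝓝 (inner ℝ (B p) v)) := fun v => by
    simpa only [ContinuousLinearMap.adjoint_inner_right] using hwp (adj B v)
  have hq' := weak_tendsto_of_sub (b := fun k => (γ / lam) • (y k - y (k + 1)) + B (w k)) hBw (by
    simpa only [add_sub_cancel_right, smul_zero] using hy'.const_smul (γ / lam))
  have he : Tendsto (fun k => γ⁻¹ • (x k - w k) - gradient f (x k)) U (𝓝 (-gradient f p)) := by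
    have := ((hw.neg.const_smul γ⁻¹)).sub hgrad
    simpa only [neg_sub, neg_zero, smul_zero, zero_sub] using this
  -- The two subgradient inequalities must be added before passing to the limit: each contains a
  -- pairing of two weakly convergent sequences, but together these reduce to ⟨Bw_k, y_k - y_{k+1}⟩
  -- → 0.
  have hmain : ∀ (z : H) (ζ : K) (a b c d : ℝ), g z = a → h ζ = b → (c : EReal) < g p →
      (d : EReal) < h (B p) →
      c + d ≤ a + b - (inner ℝ (z - p) (-gradient f p) - inner ℝ q (B z) + inner ℝ q ζ) := by
    intro z ζ a b c d hz hζ hc hd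
    have hlim₁ : Tendsto (fun k => inner ℝ (z - w k) (γ⁻¹ • (x k - w k) - gradient f (x k))) U
        (𝓝 (inner ℝ (z - p) (-gradient f p))) := by
      refine tendsto_inner_of_weak_of_strong (C := ‖z‖ + C)
        (fun k => (norm_sub_le _ _).trans (add_le_add_right (hCw k) _)) (fun v => ?_) he
      simpa only [inner_sub_left] using (hwp v).const_sub (inner ℝ z v)
    have hlim₂ : Tendsto (fun k => inner ℝ (B (w k)) (y k - y (k + 1))) U (𝓝 0) := by
      have := tendsto_inner_of_weak_of_strong (C := ‖B‖ * C)
        (fun k => (B.le_opNorm _).trans (mul_le_mul_of_nonneg_left (hCw k) (norm_nonneg _))) hBw hy'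
      simpa only [inner_zero_right] using this
    have hlim₃ : Tendsto (fun k => inner ℝ (y (k + 1)) (y k - y (k + 1))) U (𝓝 0) := by
      have := tendsto_inner_of_weak_of_strong (fun k => hCy (k + 1)) hyq' hy'
      simpa only [inner_zero_right] using this
    have hlim := ((((hlim₁.sub (hyq (B z))).add (hyq' ζ)).add hlim₂).sub
      (hlim₃.const_mul (γ / lam))).const_sub (a + b)
    rw [mul_zero, sub_zero, add_zero] at hlim
    refine ge_of_tendsto hlim ?_
    filter_upwards [hg.eventually_lt_of_weak hwp hc, hh.eventually_lt_of_weak hq' hd] with k h₁ h₂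
    obtain ⟨r, hr⟩ := hg.exists_real_of_mem_subdiff (hs.predict k)
    obtain ⟨r', hr'⟩ := hh.exists_real_of_mem_subdiff (hs.dual k)
    have h₃ := inner_add_le_of_mem_subdiff (hs.predict k) hr hz.le
    have h₄ := inner_add_le_of_mem_subdiff (hs.dual k) hr' hζ.le
    rw [hr, EReal.coe_lt_coe_iff] at h₁
    rw [hr', EReal.coe_lt_coe_iff] at h₂
    have h₅ : γ⁻¹ • (x k - γ • gradient f (x k) - γ • adj B (y k) - w k)
        = (γ⁻¹ • (x k - w k) - gradient f (x k)) - adj B (y k) := by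
      rw [show x k - γ • gradient f (x k) - γ • adj B (y k) - w k
        = (x k - w k) - γ • (gradient f (x k) + adj B (y k)) by module, smul_sub,
        inv_smul_smul₀ hγ.ne']
      abel
    rw [h₅, inner_sub_left, ContinuousLinearMap.adjoint_inner_left, map_sub, inner_sub_right (y k),
      real_inner_comm] at h₃
    rw [inner_sub_right, inner_add_right, real_inner_smul_right] at h₄
    have h₆ : inner ℝ (B (w k)) (y k - y (k + 1))
        = inner ℝ (y k) (B (w k)) - inner ℝ (y (k + 1)) (B (w k)) := by
      rw [real_inner_comm, inner_sub_left]
    rw [h₆]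
    linarith
  obtain ⟨z₀, a₀, hz₀⟩ := hg.exists_real
  obtain ⟨ζ₀, b₀, hζ₀⟩ := hh.exists_real
  obtain ⟨α, hα⟩ := exists_real_of_forall_add_le (hg.ne_bot p) (hh.ne_bot (B p))
    (hmain z₀ ζ₀ a₀ b₀ · · hz₀ hζ₀)
  obtain ⟨β, hβ⟩ := exists_real_of_forall_add_le (hh.ne_bot (B p)) (hg.ne_bot p)
    fun c d hc hd => (add_comm c d).trans_le (hmain z₀ ζ₀ a₀ b₀ d c hz₀ hζ₀ hd hc)
  have hfin : ∀ (z : H) (ζ : K) (a b : ℝ), g z = a → h ζ = b →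
      α + β ≤ a + b - (inner ℝ (z - p) (-gradient f p) - inner ℝ q (B z) + inner ℝ q ζ) := by
    intro z ζ a b hz hζ
    refine le_of_forall_pos_le_add fun ε hε => ?_
    have := hmain z ζ a b (α - ε / 2) (β - ε / 2) hz hζ
      (by rw [hα, EReal.coe_lt_coe_iff]; linarith) (by rw [hβ, EReal.coe_lt_coe_iff]; linarith)
    linarith
  -- Taking ζ = Bp, respectively z = p, separates the joint inequality into the two inclusions.
  constructor
  · refine mem_subdiff_of_forall_real hg.ne_bot hα fun z a hz => ?_
    have := hfin z (B p) a β hz hβ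
    rw [inner_sub_left, ContinuousLinearMap.adjoint_inner_left, map_sub, inner_sub_right q,
      real_inner_comm]
    linarith
  · refine mem_subdiff_of_forall_real hh.ne_bot hβ fun ζ b hζ => ?_
    have := hfin p ζ α b hα hζ
    rw [sub_self, inner_zero_left] at this
    rw [inner_sub_right]
    linarith

/-- Weak convergence of the primal iterates to a Karush-Kuhn-Tucker point. -/
theorem IsPrimalDualSeq.exists_weak_limit (hs : IsPrimalDualSeq f g h B γ lam x w y)
    (hfc : ConvexOn ℝ univ f) (hfd : Differentiable ℝ f) (hL : 0 < L)
    (hl : ∀ a b : H, ‖gradient f a - gradient f b‖ ≤ L * ‖a - b‖)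
    (hg : IsGammaZero g) (hh : IsGammaZero h) (hγ : 0 < γ) (hγL : γ < 2 / L) (hlam : 0 < lam)
    (hB : lam * ‖B‖ ^ 2 < 1) {p₀ : H} {q₀ : K} (hpq : IsKKT f g h B p₀ q₀) :
    ∃ p q, IsKKT f g h B p q ∧ ∀ v, Tendsto (fun k => inner ℝ (x k) v) atTop (𝓝 (inner ℝ p v)) := by
  obtain ⟨C, hCx, -, hCy⟩ := hs.bounded hfc hfd hL hl hg hh hγ hγL hlam hB hpq
  have hlimit : ∀ U : Ultrafilter ℕ, (U : Filter ℕ) ≤ atTop → ∃ p q, IsKKT f g h B p q ∧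
      (∀ v, Tendsto (fun k => inner ℝ (x k) v) U (𝓝 (inner ℝ p v))) ∧
      ∀ v, Tendsto (fun k => inner ℝ (y k) v) U (𝓝 (inner ℝ q v)) := by
    intro U hU
    obtain ⟨p, hp⟩ := CompositeSplitting.exists_weak_limit U hCx
    obtain ⟨q, hq⟩ := CompositeSplitting.exists_weak_limit U hCy
    exact ⟨p, q, hs.isKKT_of_weak_limit hfc hfd hL hl hg hh hγ hγL hlam hB hpq hU hp hq, hp, hq⟩
  obtain ⟨p, q, hK, hp, hq⟩ := hlimit (Ultrafilter.of atTop) (Ultrafilter.of_le atTop)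
  refine ⟨p, q, hK, fun v => (tendsto_iff_ultrafilter _ _ _).2 fun U hU => ?_⟩
  obtain ⟨p', q', hK', hp', hq'⟩ := hlimit U hU
  suffices p' = p from this ▸ hp' v
  obtain ⟨⟨l, hV⟩, -⟩ := hs.asymptotics hfc hfd hL hl hg hh hγ hγL hlam hB hK
  obtain ⟨⟨l', hV'⟩, -⟩ := hs.asymptotics hfc hfd hL hl hg hh hγ hγL hlam hB hK'
  have hc : 0 < γ ^ 2 / lam := by positivity
  set c := γ ^ 2 / lam
  -- Opial's argument: the difference of the two convergent Lyapunov functions is affine in (x_k,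
  -- y_k). Its limits along the two ultrafilters agree, which forces ‖p - p'‖² + c‖q - q'‖² = 0.
  have hlin : Tendsto (fun k => inner ℝ (x k) (p - p') + c * inner ℝ (y k) (q - q')) atTop
      (𝓝 (((l' - l) - (‖p'‖ ^ 2 - ‖p‖ ^ 2 + c * (‖q'‖ ^ 2 - ‖q‖ ^ 2))) / 2)) := by
    refine (((hV'.sub hV).sub_const _).div_const 2).congr fun k => ?_
    simp only [norm_sub_sq_real, inner_sub_right]
    ring
  have h₁ := tendsto_nhds_unique ((hp (p - p')).add ((hq (q - q')).const_mul c))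
    (hlin.mono_left (Ultrafilter.of_le atTop))
  have h₂ := tendsto_nhds_unique ((hp' (p - p')).add ((hq' (q - q')).const_mul c))
    (hlin.mono_left hU)
  have h₃ : ‖p - p'‖ ^ 2 + c * ‖q - q'‖ ^ 2 = 0 := by
    rw [← real_inner_self_eq_norm_sq, ← real_inner_self_eq_norm_sq, inner_sub_left, inner_sub_left]
    linarith
  have h₄ : ‖p - p'‖ ^ 2 ≤ 0 := by
    have : 0 ≤ c * ‖q - q'‖ ^ 2 := by positivity
    linarith
  exact (sub_eq_zero.1 (norm_eq_zero.1
    (pow_eq_zero_iff two_ne_zero |>.1 (le_antisymm h₄ (sq_nonneg _))))).symm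

end PrimalDual

/-! ### Reduction of m blocks to one -/

section Product

variable {H : Type*} [NormedAddCommGroup H] [InnerProductSpace ℝ H] [CompleteSpace H]
  {m : ℕ} {G : Fin m → Type*} [∀ i, NormedAddCommGroup (G i)] [∀ i, InnerProductSpace ℝ (G i)]
  [∀ i, CompleteSpace (G i)]

lemma sum_ne_bot {ι : Type*} (s : Finset ι) {a : ι → EReal} (h : ∀ i ∈ s, a i ≠ ⊥) :
    ∑ i ∈ s, a i ≠ ⊥ :=
  Finset.sum_induction a (· ≠ ⊥) (fun _ _ ha hb => by simp [EReal.add_eq_bot_iff, ha, hb])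
    EReal.zero_ne_bot h

lemma coe_sum {ι : Type*} (s : Finset ι) (a : ι → ℝ) :
    ((∑ i ∈ s, a i : ℝ) : EReal) = ∑ i ∈ s, (a i : EReal) := by
  classical
  induction s using Finset.induction_on with
  | empty => simp
  | insert i s hi ih => rw [Finset.sum_insert hi, Finset.sum_insert hi, EReal.coe_add, ih]

lemma mul_add_of_ne_bot {a : ℝ} (ha : 0 < a) {x y : EReal} (hx : x ≠ ⊥) (hy : y ≠ ⊥) :
    (a : EReal) * (x + y) = a * x + a * y := by
  by_cases hx' : x = ⊤
  · have : (a : EReal) * y ≠ ⊥ := by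
      by_cases hy' : y = ⊤
      · rw [hy', EReal.coe_mul_top_of_pos ha]; exact top_ne_bot
      · obtain ⟨s, rfl⟩ := exists_coe_eq hy hy'
        rw [← EReal.coe_mul]; exact EReal.coe_ne_bot _
    rw [hx', EReal.top_add_of_ne_bot hy, EReal.coe_mul_top_of_pos ha, EReal.top_add_of_ne_bot this]
  by_cases hy' : y = ⊤
  · obtain ⟨r, rfl⟩ := exists_coe_eq hx hx'
    rw [hy', EReal.coe_add_top, EReal.coe_mul_top_of_pos ha, ← EReal.coe_mul, EReal.coe_add_top]
  · obtain ⟨r, rfl⟩ := exists_coe_eq hx hx'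
    obtain ⟨s, rfl⟩ := exists_coe_eq hy hy'
    exact_mod_cast mul_add a r s

lemma mul_sum_of_ne_bot {ι : Type*} (s : Finset ι) {c : ℝ} (hc : 0 < c) {a : ι → EReal}
    (h : ∀ i, a i ≠ ⊥) : (c : EReal) * ∑ i ∈ s, a i = ∑ i ∈ s, (c : EReal) * a i := by
  classical
  induction s using Finset.induction_on with
  | empty => simp
  | insert i s hi ih =>
    rw [Finset.sum_insert hi, Finset.sum_insert hi,
      mul_add_of_ne_bot hc (h i) (sum_ne_bot s fun j _ => h j), ih]

/-- The separable sum `y ↦ ∑ i, h_i(y_i)`. -/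
noncomputable def separableSum (h : ∀ i, G i → EReal) (y : PiLp 2 G) : EReal := ∑ i, h i (y i)

omit [∀ i, CompleteSpace (G i)] in
lemma isGammaZero_separableSum {h : ∀ i, G i → EReal} (hh : ∀ i, IsGammaZero (h i)) :
    IsGammaZero (separableSum h) where
  ne_bot y := sum_ne_bot _ fun i _ => (hh i).ne_bot (y i)
  exists_ne_top := by
    choose a r har using fun i => (hh i).exists_real
    refine ⟨WithLp.toLp 2 a, ?_⟩
    simp only [separableSum, har, ← coe_sum]
    exact EReal.coe_ne_top _
  lsc := by
    have key : ∀ s : Finset (Fin m),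
        LowerSemicontinuous fun y : PiLp 2 G => ∑ i ∈ s, h i (y i) := by
      intro s
      classical
      induction s using Finset.induction_on with
      | empty => simpa using lowerSemicontinuous_const
      | insert i s hi ih =>
        simp only [Finset.sum_insert hi]
        -- Addition in `EReal` is continuous away from pairs of opposite infinities, excluded here
        -- because ⊥ is never attained.
        refine LowerSemicontinuous.add' (fun y c hc => (PiLp.continuous_apply 2 G i).continuousAt.eventually
          ((hh i).lsc (y i) c hc)) ih fun y => EReal.continuousAt_add (Or.inr ?_) (Or.inl ((hh i).ne_bot _))
        exact sum_ne_bot s fun j _ => (hh j).ne_bot _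
    exact key Finset.univ
  convex x y a b ha hb hab := by
    simp only [separableSum]
    rw [mul_sum_of_ne_bot _ ha fun i => (hh i).ne_bot _,
      mul_sum_of_ne_bot _ hb fun i => (hh i).ne_bot _, ← Finset.sum_add_distrib]
    exact Finset.sum_le_sum fun i _ => (hh i).convex (x i) (y i) a b ha hb hab

omit [∀ i, CompleteSpace (G i)] in
lemma mem_subdiff_separableSum {h : ∀ i, G i → EReal} {x v : PiLp 2 G}
    (hv : ∀ i, v i ∈ subdiff (h i) (x i)) : v ∈ subdiff (separableSum h) x := by
  intro z
  simp only [separableSum, PiLp.inner_apply, coe_sum, ← Finset.sum_add_distrib]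
  exact Finset.sum_le_sum fun i _ => hv i (z i)

/-- The operator `x ↦ (B_1 x, …, B_m x)`. -/
noncomputable def stackedOperator (B : ∀ i, H →L[ℝ] G i) : H →L[ℝ] PiLp 2 G :=
  (PiLp.continuousLinearEquiv 2 ℝ G).symm.toContinuousLinearMap.comp (ContinuousLinearMap.pi B)

omit [CompleteSpace H] [∀ i, CompleteSpace (G i)] in
@[simp]
lemma stackedOperator_apply (B : ∀ i, H →L[ℝ] G i) (x : H) (i : Fin m) :
    stackedOperator B x i = B i x := rfl

lemma adjoint_stackedOperator (B : ∀ i, H →L[ℝ] G i) (y : PiLp 2 G) :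
    ContinuousLinearMap.adjoint (stackedOperator B) y = adjointSum B y := by
  refine ext_inner_right ℝ fun x => ?_
  rw [ContinuousLinearMap.adjoint_inner_left, PiLp.inner_apply, adjointSum, sum_inner]
  exact Finset.sum_congr rfl fun i _ => (ContinuousLinearMap.adjoint_inner_left _ _ _).symm

omit [CompleteSpace H] [∀ i, CompleteSpace (G i)] in
lemma norm_stackedOperator_sq_le (B : ∀ i, H →L[ℝ] G i) :
    ‖stackedOperator B‖ ^ 2 ≤ ∑ i, ‖B i‖ ^ 2 := by
  have hnn : 0 ≤ ∑ i, ‖B i‖ ^ 2 := Finset.sum_nonneg fun i _ => sq_nonneg _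
  have hle : ‖stackedOperator B‖ ≤ √(∑ i, ‖B i‖ ^ 2) := by
    refine ContinuousLinearMap.opNorm_le_bound _ (Real.sqrt_nonneg _) fun x => ?_
    refine le_of_sq_le_sq ?_ (by positivity)
    rw [PiLp.norm_sq_eq_of_L2, mul_pow, Real.sq_sqrt hnn, Finset.sum_mul]
    refine Finset.sum_le_sum fun i _ => ?_
    rw [stackedOperator_apply, ← mul_pow]
    exact pow_le_pow_left₀ (norm_nonneg _) ((B i).le_opNorm x) 2
  calc ‖stackedOperator B‖ ^ 2 ≤ √(∑ i, ‖B i‖ ^ 2) ^ 2 := by gcongr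
    _ = _ := Real.sq_sqrt hnn

/-- Each dual component is handled by Moreau's decomposition with parameter λ/γ, whose inverse is
the factor γ/λ in the dual inclusion. -/
lemma IsGenerated.isPrimalDualSeq {f : H → ℝ} {g : H → EReal} (hg : IsGammaZero g)
    {h : ∀ i, G i → EReal} (hh : ∀ i, IsGammaZero (h i)) {B : ∀ i, H →L[ℝ] G i} {γ lam : ℝ}
    (hγ : 0 < γ) (hlam : 0 < lam) {u : ℕ → H} {y : ℕ → PiLp 2 G} {x : ℕ → H}
    (hgen : IsGenerated f g h B γ lam (fun _ => 1) u y x) :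
    IsPrimalDualSeq f g (separableSum h) (stackedOperator B) γ lam x
      (fun k => prox γ g (u k - γ • adjointSum B (y k))) y where
  primal k := by
    rw [adjoint_stackedOperator, ← hgen.u_eq, hgen.x_succ]
    exact hg.mem_subdiff_prox hγ _
  predict k := by
    rw [adjoint_stackedOperator, ← hgen.u_eq]
    exact hg.mem_subdiff_prox hγ _
  dual k := by
    have hy : ∀ i, y (k + 1) i = prox (lam / γ) (fenchelConj (h i))
        (y k i + (lam / γ) • B i (prox γ g (u k - γ • adjointSum B (y k)))) := fun i => by
      rw [hgen.y_succ, Function.iterate_one, innerStep]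
    refine mem_subdiff_separableSum fun i => ?_
    have hpos : 0 < lam / γ := div_pos hlam hγ
    have := (hh i).prox_fenchelConj_mem_subdiff hpos
      (y k i + (lam / γ) • B i (prox γ g (u k - γ • adjointSum B (y k))))
    rw [← hy] at this
    convert this using 1
    rw [add_sub_right_comm, smul_add, inv_smul_smul₀ hpos.ne', inv_div]
    rfl

/-- The subgradient inequalities for f, g and h add up, and their linear terms cancel. -/
lemma IsKKT.isMinOn_objective {f : H → ℝ} (hfc : ConvexOn ℝ univ f) (hfd : Differentiable ℝ f)
    {g : H → EReal} (hg : IsGammaZero g) {h : ∀ i, G i → EReal} (hh : ∀ i, IsGammaZero (h i))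
    {B : ∀ i, H →L[ℝ] G i} {p : H} {q : PiLp 2 G}
    (hpq : IsKKT f g (separableSum h) (stackedOperator B) p q) :
    IsMinOn (objective f g h B) univ p := by
  have hs := isGammaZero_separableSum hh
  have hobj : ∀ z, objective f g h B z = f z + g z + separableSum h (stackedOperator B z) :=
    fun z => rfl
  intro z _
  rw [mem_ofPred_eq, hobj, hobj]
  have hbot : (f z : EReal) + g z ≠ ⊥ := by simp [EReal.add_eq_bot_iff, hg.ne_bot z]
  by_cases hgz : g z = ⊤
  · rw [hgz, EReal.coe_add_top, EReal.top_add_of_ne_bot (hs.ne_bot _)]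
    exact le_top
  by_cases hhz : separableSum h (stackedOperator B z) = ⊤
  · rw [hhz, EReal.add_top_of_ne_bot hbot]
    exact le_top
  obtain ⟨a, ha⟩ := exists_coe_eq (hg.ne_bot z) hgz
  obtain ⟨b, hb⟩ := exists_coe_eq (hs.ne_bot _) hhz
  obtain ⟨α, hα⟩ := hg.exists_real_of_mem_subdiff hpq.primal
  obtain ⟨β, hβ⟩ := hs.exists_real_of_mem_subdiff hpq.dual
  have h₁ := inner_add_le_of_mem_subdiff hpq.primal hα ha.le
  have h₂ := inner_add_le_of_mem_subdiff hpq.dual hβ hb.le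
  have h₃ := inner_gradient_le_sub hfc hfd p z
  rw [← map_sub] at h₂
  rw [inner_sub_left, inner_neg_left, ContinuousLinearMap.adjoint_inner_left] at h₁
  rw [ha, hb, hα, hβ]
  exact_mod_cast (by linarith : f p + α + β ≤ f z + a + b)

lemma tendsto_toWeakSpace {ι : Type*} {l : Filter ι} {a : ι → H} {p : H}
    (h : ∀ v, Tendsto (fun i => inner ℝ (a i) v) l (𝓝 (inner ℝ p v))) :
    Tendsto (fun i => toWeakSpace ℝ H (a i)) l (𝓝 (toWeakSpace ℝ H p)) := by
  have hinj : Function.Injective (topDualPairing ℝ H).flip := fun y z hyz =>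
    ext_inner_left ℝ fun v => by
      simpa using LinearMap.congr_fun hyz (toDual ℝ H v)
  refine (WeakBilin.tendsto_iff_forall_eval_tendsto _ hinj).2 fun F => ?_
  have hF : ∀ z, F z = inner ℝ z ((toDual ℝ H).symm F) := fun z => by
    rw [real_inner_comm, toDual_symm_apply]
  have := h ((toDual ℝ H).symm F)
  simp only [← hF] at this
  exact this

end Product

end CompositeSplitting

/-! ### Weak convergence for the m-block problem -/

theorem theorem4p4 {H : Type*} [NormedAddCommGroup H] [InnerProductSpace ℝ H] [CompleteSpace H]
    {m : ℕ} (hm : 1 ≤ m)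
    {G : Fin m → Type*} [∀ i, NormedAddCommGroup (G i)] [∀ i, InnerProductSpace ℝ (G i)]
    [∀ i, CompleteSpace (G i)]
    (f : H → ℝ) (hf_convex : ConvexOn ℝ univ f) (hf_diff : Differentiable ℝ f)
    (L : ℝ) (hL : 0 < L)
    (hf_lip : ∀ a b : H, ‖gradient f a - gradient f b‖ ≤ L * ‖a - b‖)
    (g : H → EReal) (hg : CompositeSplitting.IsGammaZero g)
    (h : ∀ i, G i → EReal) (hh : ∀ i, CompositeSplitting.IsGammaZero (h i))
    (B : ∀ i, H →L[ℝ] G i)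
    -- `0 ∈ ∇f(x) + ∂g(x) + ∑ i, B_i^* ∂h_i(B_i x)` for some `x`
    (hKKT : ∃ (xs : H) (ys : PiLp 2 G),
      -gradient f xs - CompositeSplitting.adjointSum B ys ∈ CompositeSplitting.subdiff g xs ∧
      ∀ i, ys i ∈ CompositeSplitting.subdiff (h i) (B i xs))
    (γ lam : ℝ) (hγ : 0 < γ) (hγL : γ < 2 / L)
    -- `lam < 1 / ∑ i, ‖B i‖ ^ 2`, with `1 / 0 = +∞`
    (hlam : 0 < lam) (hlamB : lam * ∑ i, ‖B i‖ ^ 2 < 1)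
    (u : ℕ → H) (y : ℕ → PiLp 2 G) (x : ℕ → H)
    (hgen : CompositeSplitting.IsGenerated f g h B γ lam (fun _ => 1) u y x) :
    ∃ xsol : H,
      IsMinOn (CompositeSplitting.objective f g h B) univ xsol ∧
      Tendsto (fun k => toWeakSpace ℝ H (x k)) atTop (𝓝 (toWeakSpace ℝ H xsol)) := by

  obtain ⟨xs, ys, hprimal, hdual⟩ := hKKT
  have hkkt : CompositeSplitting.IsKKT f g (CompositeSplitting.separableSum h)
      (CompositeSplitting.stackedOperator B) xs ys :=
    ⟨by rwa [CompositeSplitting.adjoint_stackedOperator],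
      CompositeSplitting.mem_subdiff_separableSum hdual⟩
  have hB : lam * ‖CompositeSplitting.stackedOperator B‖ ^ 2 < 1 :=
    (mul_le_mul_of_nonneg_left (CompositeSplitting.norm_stackedOperator_sq_le B) hlam.le).trans_lt
      hlamB
  obtain ⟨p, q, hpq, hlim⟩ := (hgen.isPrimalDualSeq hg hh hγ hlam).exists_weak_limit hf_convex
    hf_diff hL hf_lip hg (CompositeSplitting.isGammaZero_separableSum hh) hγ hγL hlam hB hkkt
  exact ⟨p, hpq.isMinOn_objective hf_convex hf_diff hg hh,
    CompositeSplitting.tendsto_toWeakSpace hlim⟩
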